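/- Let $\Gamma$ and $\gamma$ be circles in the Euclidean plane of radii $R>r>0$ whose centres are at distance $d>0$, where $d^2=(R-r)^2-4Rr$ (so $\gamma$ lies inside $\Gamma$), and put $a=1/r$, $A=-1/R$. A Steiner $4$-chain with parent circles $\Gamma,\gamma$ is a sequence of four distinct circles $\delta_1,\dots,\delta_4$ of positive radius, with cyclically consecutive ones externally tangent, each internally tangent to $\Gamma$ and externally tangent to $\gamma$; its area is the sum of the areas of the four disks bounded by the $\delta_i$. The axis is the line through the centres of $\Gamma$ and $\gamma$. A chain is axi-symmetric if the reflection in the axis maps each of its circles to one of its circles. A chain is axial if it contains a circle of the largest and a circle of the smallest radius occurring in any Steiner $4$-chain with parent circles $\Gamma,\gamma$. A chain is lateral if it is axi-symmetric, has exactly two common points with the axis, and every circle of the chain through such a point is tangent to the axis there. Then the axi-symmetric chains are exactly the axial and the lateral ones. As an unordered set of circles, there is exactly one axial chain and exactly one lateral chain; over the labelled lateral chains the curvature of the first circle $\delta_1$ takes exactly two values. Among all Steiner $4$-chains with parent circles $\Gamma,\gamma$ (as labelled chains, closeness being measured by centres and radii), the local maxima of the area are exactly the axial chains and the local minima are exactly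 the lateral chains. The maximum of the area exists and equals $$\pi\,\frac{A^4+6A^3a+18A^2a^2+6Aa^3+a^4}{A^2a^2(a+A)^2},$$ and a chain has this area if and only if it is axial. The minimum of the area exists and equals $$\pi\,\frac{32(3a+A)(a+3A)}{(a-A)^4},$$ and a chain has this area if and only if it is lateral. -/

import Mathlib

open EuclideanGeometry MeasureTheory

/-- The Euclidean plane. -/
abbrev Plane : Type := EuclideanSpace ℝ (Fin 2)

/-- The circles `Γ` (outer) and `γ` (inner) of radii `R > r > 0` with distinct centres at distance
`d`, where `d ^ 2 = (R - r) ^ 2 - 4 q R r` and `q = tan² (π / 4) = 1`: the parent circles of a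
poristic system of Steiner 4-chains. The relation forces `d < R - r`, so that `γ` lies in the open
disk bounded by `Γ`. -/
structure IsParentPair (Γ γ : Sphere Plane) : Prop where
  radius_pos : 0 < γ.radius
  radius_lt : γ.radius < Γ.radius
  center_ne : Γ.center ≠ γ.center
  gauge : dist Γ.center γ.center ^ 2 =
    (Γ.radius - γ.radius) ^ 2 - 4 * Real.tan (Real.pi / 4) ^ 2 * Γ.radius * γ.radius

/-- A (labelled) Steiner 4-chain with parent circles `Γ` and `γ`: four distinct circles, cyclically
externally tangent, each internally tangent to `Γ` and externally tangent to `γ`.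
The index `i + 1` is taken modulo 4. -/
structure IsSteinerChain (Γ γ : Sphere Plane) (C : Fin 4 → Sphere Plane) : Prop where
  radius_pos : ∀ i, 0 < (C i).radius
  injective : Function.Injective C
  outer : ∀ i, (C i).IsIntTangent Γ
  inner : ∀ i, (C i).IsExtTangent γ
  adjacent : ∀ i, (C i).IsExtTangent (C (i + 1))

/-- The total area of the four disks bounded by the circles of a chain. -/
noncomputable def chainArea (C : Fin 4 → Sphere Plane) : ℝ :=
  ∑ i, volume.real (Metric.closedBall (C i).center (C i).radius)

/-- The axis of the porism: the line through the centres of the parent circles. -/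
noncomputable def porismAxis (Γ γ : Sphere Plane) : AffineSubspace ℝ Plane :=
  line[ℝ, Γ.center, γ.center]

instance porismAxis_nonempty (Γ γ : Sphere Plane) : Nonempty (porismAxis Γ γ) :=
  ⟨⟨Γ.center, left_mem_affineSpan_pair ℝ Γ.center γ.center⟩⟩

/-- The chain is axi-symmetric: the reflection in the axis of the porism maps each of its circles
to one of its circles. -/
def IsAxiSymmetric (Γ γ : Sphere Plane) (C : Fin 4 → Sphere Plane) : Prop :=
  ∀ i, ∃ j, (C j).center = reflection (porismAxis Γ γ) (C i).center ∧
    (C j).radius = (C i).radius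

/-- The radii of all circles that occur in Steiner 4-chains with the given parent circles. -/
def poristicRadii (Γ γ : Sphere Plane) : Set ℝ :=
  {ρ | ∃ C, IsSteinerChain Γ γ C ∧ ∃ i, (C i).radius = ρ}

/-- An axial chain: a Steiner 4-chain that contains a circle of the biggest possible radius and a
circle of the smallest possible radius. -/
structure IsAxialChain (Γ γ : Sphere Plane) (C : Fin 4 → Sphere Plane) : Prop where
  chain : IsSteinerChain Γ γ C
  biggest : ∃ i, IsGreatest (poristicRadii Γ γ) (C i).radius
  smallest : ∃ i, IsLeast (poristicRadii Γ γ) (C i).radius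

/-- A lateral chain: an axi-symmetric Steiner 4-chain that has exactly two common points with the
axis, such that every circle of the chain passing through one of them is tangent to the axis
there. -/
structure IsLateralChain (Γ γ : Sphere Plane) (C : Fin 4 → Sphere Plane) : Prop where
  chain : IsSteinerChain Γ γ C
  symmetric : IsAxiSymmetric Γ γ C
  two_points : {p : Plane | p ∈ porismAxis Γ γ ∧ ∃ i, p ∈ C i}.ncard = 2
  tangent : ∀ i, ∀ p ∈ porismAxis Γ γ, p ∈ C i → (C i).IsTangentAt p (porismAxis Γ γ)

/-- The labelled 4-tuples `C` and `D` of circles are `ε`-close: corresponding centres and radii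
differ by less than `ε`. -/
def ChainsClose (ε : ℝ) (C D : Fin 4 → Sphere Plane) : Prop :=
  ∀ i, dist (C i).center (D i).center < ε ∧ |(C i).radius - (D i).radius| < ε

/-- `C` is a local maximum of the area on the family of Steiner 4-chains with parent circles
`Γ` and `γ`. -/
def IsLocalMaxArea (Γ γ : Sphere Plane) (C : Fin 4 → Sphere Plane) : Prop :=
  IsSteinerChain Γ γ C ∧
    ∃ ε > 0, ∀ D, IsSteinerChain Γ γ D → ChainsClose ε C D → chainArea D ≤ chainArea C

/-- `C` is a local minimum of the area on the family of Steiner 4-chains with parent circles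
`Γ` and `γ`. -/
def IsLocalMinArea (Γ γ : Sphere Plane) (C : Fin 4 → Sphere Plane) : Prop :=
  IsSteinerChain Γ γ C ∧
    ∃ ε > 0, ∀ D, IsSteinerChain Γ γ D → ChainsClose ε C D → chainArea C ≤ chainArea D

/-! Write R, r for the radii of Γ, γ. A circle tangent to both parents is described by an angle θ
with cosine u and sine w: its curvature is affine in u, and its distance from the axis is √2 |w|
times its radius. This is its angular position after the parents are inverted into concentric
circles. Two such circles of radii s, s' have centres at squared distance (s + s')² - 4ss' cos(θ -
θ') (`porismCircle_dist_sq`), so they are externally tangent exactly when their angles differ by a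
quarter turn. Hence a chain is θ, θ + π/2, θ + π, θ + 3π/2 in one of the two senses
(`isSteinerChain_iff`), and θ is free.

Every property now reads off from (u, w). Reflection in the axis changes the sign of w, so
axi-symmetry means uw = 0 or u² = w². The extreme radii sit at u = ±1, so axial means uw = 0. A
circle touches the axis when 2w² = 1, so lateral means u² = w².

The four curvatures belong to ±u and ±w, so the sum of the squared radii is a symmetric function
that depends only on p = u²w², with 0 ≤ p ≤ 1/4 (`chainArea_porismChain`). It strictly decreases in
p (`porismArea_strictAnti`). The maximum is therefore at p = 0, the axial case, and the minimum at p
= 1/4, the lateral case. Along the family p = cos²θ sin²θ has no other local extrema, which settles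
the local statements. -/

/-! ### Cartesian coordinates adapted to the axis. -/

theorem Plane.dist_sq (p q : Plane) : dist p q ^ 2 = (p 0 - q 0) ^ 2 + (p 1 - q 1) ^ 2 := by
  rw [EuclideanSpace.dist_eq, Real.sq_sqrt (by positivity), Fin.sum_univ_two,
    Real.dist_eq, Real.dist_eq, sq_abs, sq_abs]

/-- The point with coordinates `x`, `y` in the orthonormal frame with origin `O` whose first axis
passes through `I`. -/
noncomputable def framePoint (O I : Plane) (x y : ℝ) : Plane :=
  !₂[O 0 + (x * (I 0 - O 0) - y * (I 1 - O 1)) / dist O I,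
    O 1 + (x * (I 1 - O 1) + y * (I 0 - O 0)) / dist O I]

section Frame

variable {O I : Plane}

theorem framePoint_apply_zero (x y : ℝ) :
    framePoint O I x y 0 = O 0 + (x * (I 0 - O 0) - y * (I 1 - O 1)) / dist O I := by
  simp [framePoint]

theorem framePoint_apply_one (x y : ℝ) :
    framePoint O I x y 1 = O 1 + (x * (I 1 - O 1) + y * (I 0 - O 0)) / dist O I := by
  simp [framePoint]

theorem framePoint_dist_sq (h : O ≠ I) (x y x' y' : ℝ) :
    dist (framePoint O I x y) (framePoint O I x' y') ^ 2 = (x - x') ^ 2 + (y - y') ^ 2 := by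
  have hd : dist O I ≠ 0 := dist_ne_zero.2 h
  have hd2 := Plane.dist_sq O I
  rw [Plane.dist_sq]
  simp only [framePoint_apply_zero, framePoint_apply_one]
  field_simp
  rw [hd2]
  ring

theorem framePoint_zero_zero : framePoint O I 0 0 = O := by
  ext i
  fin_cases i <;> simp [framePoint]

theorem framePoint_dist_zero (h : O ≠ I) : framePoint O I (dist O I) 0 = I := by
  have hd : dist O I ≠ 0 := dist_ne_zero.2 h
  ext i
  fin_cases i <;> simp [framePoint] <;> field_simp <;> ring

theorem framePoint_inj (h : O ≠ I) {x y x' y' : ℝ} :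
    framePoint O I x y = framePoint O I x' y' ↔ x = x' ∧ y = y' := by
  refine ⟨fun e => ?_, fun ⟨e, e'⟩ => by rw [e, e']⟩
  have := framePoint_dist_sq h x y x' y'
  rw [e, dist_self] at this
  constructor <;> nlinarith [sq_nonneg (x - x'), sq_nonneg (y - y')]

theorem exists_framePoint_eq (h : O ≠ I) (p : Plane) : ∃ x y, framePoint O I x y = p := by
  have hd : dist O I ≠ 0 := dist_ne_zero.2 h
  have hd2 := Plane.dist_sq O I
  refine ⟨((p 0 - O 0) * (I 0 - O 0) + (p 1 - O 1) * (I 1 - O 1)) / dist O I,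
    (-(p 0 - O 0) * (I 1 - O 1) + (p 1 - O 1) * (I 0 - O 0)) / dist O I, ?_⟩
  ext i
  fin_cases i
  · simp only [Fin.zero_eta, framePoint_apply_zero]
    field_simp
    rw [hd2]
    ring
  · simp only [Fin.mk_one, framePoint_apply_one]
    field_simp
    rw [hd2]
    ring

theorem framePoint_mem_line_iff (h : O ≠ I) {x y : ℝ} :
    framePoint O I x y ∈ line[ℝ, O, I] ↔ y = 0 := by
  have hd : dist O I ≠ 0 := dist_ne_zero.2 h
  have key : ∀ t : ℝ, AffineMap.lineMap O I t = framePoint O I (t * dist O I) 0 := by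
    intro t
    ext i
    fin_cases i <;> simp [framePoint, AffineMap.lineMap_apply] <;> field_simp <;> ring
  rw [mem_affineSpan_pair_iff_exists_lineMap_eq]
  simp only [key, framePoint_inj h]
  refine ⟨fun ⟨_, _, e⟩ => e.symm, fun e => ⟨x / dist O I, ?_, e.symm⟩⟩
  field_simp

theorem framePoint_inner (h : O ≠ I) (x₁ y₁ x₂ y₂ x₃ y₃ x₄ y₄ : ℝ) :
    inner ℝ (framePoint O I x₁ y₁ -ᵥ framePoint O I x₂ y₂)
      (framePoint O I x₃ y₃ -ᵥ framePoint O I x₄ y₄) =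
      (x₁ - x₂) * (x₃ - x₄) + (y₁ - y₂) * (y₃ - y₄) := by
  have hd : dist O I ≠ 0 := dist_ne_zero.2 h
  have hd2 := Plane.dist_sq O I
  simp only [vsub_eq_sub, PiLp.inner_apply, Fin.sum_univ_two, PiLp.sub_apply,
    framePoint_apply_zero, framePoint_apply_one, RCLike.inner_apply, conj_trivial]
  field_simp
  rw [hd2]
  ring

theorem continuous_framePoint {X : Type*} [TopologicalSpace X] {f g : X → ℝ}
    (hf : Continuous f) (hg : Continuous g) : Continuous fun t => framePoint O I (f t) (g t) := by
  unfold framePoint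
  simp only [div_eq_mul_inv]
  fun_prop

end Frame

/-- The foot of the perpendicular has coordinates (x, 0), and the remaining vector is orthogonal to
the axis, so reflection negates it. -/
theorem reflection_framePoint (Γ γ : Sphere Plane) (h : Γ.center ≠ γ.center) (x y : ℝ) :
    reflection (porismAxis Γ γ) (framePoint Γ.center γ.center x y) =
      framePoint Γ.center γ.center x (-y) := by
  have hx : framePoint Γ.center γ.center x 0 ∈ porismAxis Γ γ := (framePoint_mem_line_iff h).2 rfl
  have hv : framePoint Γ.center γ.center x y -ᵥ framePoint Γ.center γ.center x 0 ∈
      (porismAxis Γ γ).directionᗮ := by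
    rw [Submodule.mem_orthogonal]
    intro v hv
    rw [AffineSubspace.mem_direction_iff_eq_vsub ⟨_, hx⟩] at hv
    obtain ⟨p, hp, q, hq, rfl⟩ := hv
    obtain ⟨a, b, rfl⟩ := exists_framePoint_eq h p
    obtain ⟨a', b', rfl⟩ := exists_framePoint_eq h q
    rw [framePoint_inner h, (framePoint_mem_line_iff h).1 hp, (framePoint_mem_line_iff h).1 hq]
    ring
  have := reflection_orthogonal_vadd hx hv
  rw [vsub_vadd] at this
  rw [this]
  ext i
  fin_cases i <;> simp [framePoint] <;> ring

/-! ### Numerical consequences of the closure relation. -/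

theorem IsParentPair.dist_pos {Γ γ : Sphere Plane} (h : IsParentPair Γ γ) :
    0 < dist Γ.center γ.center := _root_.dist_pos.2 h.center_ne

theorem IsParentPair.dist_sq {Γ γ : Sphere Plane} (h : IsParentPair Γ γ) :
    dist Γ.center γ.center ^ 2 =
      Γ.radius ^ 2 - 6 * Γ.radius * γ.radius + γ.radius ^ 2 := by
  rw [h.gauge, Real.tan_pi_div_four]
  ring

theorem IsParentPair.outer_pos {Γ γ : Sphere Plane} (h : IsParentPair Γ γ) : 0 < Γ.radius :=
  h.radius_pos.trans h.radius_lt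

theorem IsParentPair.dist_lt {Γ γ : Sphere Plane} (h : IsParentPair Γ γ) :
    dist Γ.center γ.center < Γ.radius - γ.radius := by
  have := mul_pos h.outer_pos h.radius_pos
  exact lt_of_pow_lt_pow_left₀ 2 (by linarith [h.radius_lt]) (by nlinarith [h.dist_sq])

/-- The curvature of the circle with angular parameter of cosine `u` that is tangent to both
parent circles. -/
noncomputable def porismCurvature (Γ γ : Sphere Plane) (u : ℝ) : ℝ :=
  (Γ.radius - γ.radius + dist Γ.center γ.center * u) / (2 * Γ.radius * γ.radius)

/-- The circle tangent to both parent circles with angular parameter of cosine `u` and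
sine `w`. -/
noncomputable def porismCircle (Γ γ : Sphere Plane) (u w : ℝ) : Sphere Plane where
  center := framePoint Γ.center γ.center
    ((Γ.radius * (Γ.radius - 3 * γ.radius)
      - (Γ.radius + γ.radius) * (porismCurvature Γ γ u)⁻¹) / dist Γ.center γ.center)
    (√2 * w * (porismCurvature Γ γ u)⁻¹)
  radius := (porismCurvature Γ γ u)⁻¹

/-! ### Circles tangent to both parents, parametrised by an angle. -/

section Circles

variable {Γ γ : Sphere Plane}

theorem porismCurvature_pos (h : IsParentPair Γ γ) {u : ℝ} (hu : -1 ≤ u) :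
    0 < porismCurvature Γ γ u := by
  have := mul_pos h.outer_pos h.radius_pos
  refine div_pos ?_ (by linarith)
  nlinarith [h.dist_lt, h.dist_pos]

theorem porismCurvature_mul (h : IsParentPair Γ γ) (u : ℝ) :
    porismCurvature Γ γ u * (2 * Γ.radius * γ.radius) =
      Γ.radius - γ.radius + dist Γ.center γ.center * u := by
  have := h.outer_pos.ne'
  have := h.radius_pos.ne'
  unfold porismCurvature
  field_simp

theorem porismCurvature_inj (h : IsParentPair Γ γ) {u u' : ℝ} :
    porismCurvature Γ γ u = porismCurvature Γ γ u' ↔ u = u' := by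
  refine ⟨fun e => ?_, fun e => by rw [e]⟩
  have h1 := porismCurvature_mul h u
  rw [e, porismCurvature_mul h u'] at h1
  exact (mul_left_cancel₀ h.dist_pos.ne' (add_left_cancel h1)).symm

theorem porismCircle_radius_pos (h : IsParentPair Γ γ) {u : ℝ} (hu : -1 ≤ u) (w : ℝ) :
    0 < (porismCircle Γ γ u w).radius := inv_pos.2 (porismCurvature_pos h hu)

theorem neg_one_le_of_sq_add_sq {u w : ℝ} (h : u ^ 2 + w ^ 2 = 1) : -1 ≤ u := by
  nlinarith [sq_nonneg w]

theorem le_one_of_sq_add_sq {u w : ℝ} (h : u ^ 2 + w ^ 2 = 1) : u ≤ 1 := by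
  nlinarith [sq_nonneg w]

theorem porismCircle_inj (h : IsParentPair Γ γ) {u w u' w' : ℝ} (hu : -1 ≤ u) :
    porismCircle Γ γ u w = porismCircle Γ γ u' w' ↔ u = u' ∧ w = w' := by
  refine ⟨fun e => ?_, fun ⟨e, e'⟩ => by rw [e, e']⟩
  have hr := congrArg Sphere.radius e
  have hc := congrArg Sphere.center e
  have huu : u = u' := (porismCurvature_inj h).1 (inv_injective hr)
  subst huu
  have := ((framePoint_inj h.center_ne).1 hc).2
  refine ⟨rfl, ?_⟩
  have h2 : √2 ≠ 0 := by positivity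
  exact mul_left_cancel₀ h2
    (mul_right_cancel₀ (inv_ne_zero (porismCurvature_pos h hu).ne') this)

/-- This turns tangency into a condition on the difference of the angles: u u' + w w' is its cosine.
-/
theorem porismCircle_dist_sq (h : IsParentPair Γ γ) {u w u' w' : ℝ} (hu : u ^ 2 + w ^ 2 = 1)
    (hu' : u' ^ 2 + w' ^ 2 = 1) :
    dist (porismCircle Γ γ u w).center (porismCircle Γ γ u' w').center ^ 2 =
      ((porismCircle Γ γ u w).radius + (porismCircle Γ γ u' w').radius) ^ 2
      - 4 * (porismCircle Γ γ u w).radius * (porismCircle Γ γ u' w').radius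
        * (u * u' + w * w') := by
  have hk := (porismCurvature_pos h (neg_one_le_of_sq_add_sq hu)).ne'
  have hk' := (porismCurvature_pos h (neg_one_le_of_sq_add_sq hu')).ne'
  have hm := porismCurvature_mul h u
  have hm' := porismCurvature_mul h u'
  have hd := h.dist_pos.ne'
  have hd2 := h.dist_sq
  have hR := h.outer_pos.ne'
  have hr := h.radius_pos.ne'
  simp only [porismCircle, framePoint_dist_sq h.center_ne]
  generalize porismCurvature Γ γ u = k at *
  generalize porismCurvature Γ γ u' = k' at *
  generalize dist Γ.center γ.center = d at *
  generalize Γ.radius = R at *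
  generalize γ.radius = r at *
  have hu1 : w ^ 2 = 1 - u ^ 2 := by linarith
  have hu1' : w' ^ 2 = 1 - u' ^ 2 := by linarith
  have s2 : √2 ^ 2 = 2 := Real.sq_sqrt (by norm_num)
  -- The claim with the denominator d² k² k'² cleared. The factor √2 in the ordinate makes the
  -- products w w' cancel; `e1`, `e2` and `e3` then express everything through the curvatures.
  have key : (R + r) ^ 2 * (k' - k) ^ 2 + 2 * d ^ 2 * (w * k' - w' * k) ^ 2
      = d ^ 2 * ((k + k') ^ 2 - 4 * k * k' * (u * u' + w * w')) := by
    have e1 : d ^ 2 * w ^ 2 = R ^ 2 - 6 * R * r + r ^ 2 - (k * (2 * R * r) - (R - r)) ^ 2 := by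
      rw [hm, hu1, ← hd2]; ring
    have e2 : d ^ 2 * w' ^ 2 = R ^ 2 - 6 * R * r + r ^ 2 - (k' * (2 * R * r) - (R - r)) ^ 2 := by
      rw [hm', hu1', ← hd2]; ring
    have e3 : d ^ 2 * (u * u') =
        (k * (2 * R * r) - (R - r)) * (k' * (2 * R * r) - (R - r)) := by
      rw [hm, hm']; ring
    linear_combination 2 * k' ^ 2 * e1 + 2 * k ^ 2 * e2 + 4 * k * k' * e3 - (k + k') ^ 2 * hd2
  have hl : ((R * (R - 3 * r) - (R + r) * k⁻¹) / d - (R * (R - 3 * r) - (R + r) * k'⁻¹) / d) ^ 2 +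
      (√2 * w * k⁻¹ - √2 * w' * k'⁻¹) ^ 2 =
      ((R + r) ^ 2 * (k' - k) ^ 2 + √2 ^ 2 * d ^ 2 * (w * k' - w' * k) ^ 2)
        / (d ^ 2 * k ^ 2 * k' ^ 2) := by
    field_simp
    ring
  rw [hl, s2, key]
  field_simp
  ring

theorem isExtTangent_porismCircle_iff (h : IsParentPair Γ γ) {u w u' w' : ℝ}
    (hu : u ^ 2 + w ^ 2 = 1) (hu' : u' ^ 2 + w' ^ 2 = 1) :
    (porismCircle Γ γ u w).IsExtTangent (porismCircle Γ γ u' w') ↔ u * u' + w * w' = 0 := by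
  have p := porismCircle_radius_pos h (neg_one_le_of_sq_add_sq hu) w
  have p' := porismCircle_radius_pos h (neg_one_le_of_sq_add_sq hu') w'
  have hD := porismCircle_dist_sq h hu hu'
  rw [Sphere.isExtTangent_iff_dist_center]
  refine ⟨fun ⟨e, _⟩ => ?_, fun e => ⟨?_, p.le, p'.le⟩⟩
  · rw [e] at hD
    have : (porismCircle Γ γ u w).radius * (porismCircle Γ γ u' w').radius
        * (u * u' + w * w') = 0 := by linarith
    exact (mul_eq_zero.1 this).resolve_left (mul_pos p p').ne'
  · rw [e, mul_zero, sub_zero] at hD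
    exact (sq_eq_sq₀ dist_nonneg (by positivity)).1 hD

theorem porismCircle_outer_inner (h : IsParentPair Γ γ) {u w : ℝ} (hu : u ^ 2 + w ^ 2 = 1) :
    (porismCircle Γ γ u w).IsIntTangent Γ ∧ (porismCircle Γ γ u w).IsExtTangent γ := by
  have p := porismCircle_radius_pos h (neg_one_le_of_sq_add_sq hu) w
  have hk := porismCurvature_pos h (neg_one_le_of_sq_add_sq hu)
  have hm := porismCurvature_mul h u
  have hd := h.dist_pos
  have hd2 := h.dist_sq
  have hdl := h.dist_lt
  have hR := h.outer_pos
  have hr := h.radius_pos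
  have hu1 := neg_one_le_of_sq_add_sq hu
  have ho := framePoint_dist_sq h.center_ne ((Γ.radius * (Γ.radius - 3 * γ.radius)
      - (Γ.radius + γ.radius) * (porismCurvature Γ γ u)⁻¹) / dist Γ.center γ.center)
    (√2 * w * (porismCurvature Γ γ u)⁻¹) 0 0
  have hi := framePoint_dist_sq h.center_ne ((Γ.radius * (Γ.radius - 3 * γ.radius)
      - (Γ.radius + γ.radius) * (porismCurvature Γ γ u)⁻¹) / dist Γ.center γ.center)
    (√2 * w * (porismCurvature Γ γ u)⁻¹) (dist Γ.center γ.center) 0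
  rw [framePoint_zero_zero] at ho
  rw [framePoint_dist_zero h.center_ne] at hi
  have hw : w ^ 2 = 1 - u ^ 2 := by linarith
  have s2 : √2 ^ 2 = 2 := Real.sq_sqrt (by norm_num)
  have hRk : 0 ≤ Γ.radius - (porismCurvature Γ γ u)⁻¹ := by
    rw [sub_nonneg, inv_le_iff_one_le_mul₀ hk]
    refine le_of_mul_le_mul_right (a := 2 * γ.radius) ?_ (by linarith)
    rw [show Γ.radius * porismCurvature Γ γ u * (2 * γ.radius)
      = porismCurvature Γ γ u * (2 * Γ.radius * γ.radius) by ring, hm]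
    -- By the closure relation d² = (R - 3r)² - 8r². The bound keeps the radius of the circle below
    -- R even at u = -1.
    have : dist Γ.center γ.center < Γ.radius - 3 * γ.radius :=
      lt_of_pow_lt_pow_left₀ 2 (by nlinarith) (by nlinarith)
    nlinarith
  have e1 : dist Γ.center γ.center ^ 2 * w ^ 2 = dist Γ.center γ.center ^ 2 -
      (porismCurvature Γ γ u * (2 * Γ.radius * γ.radius) - (Γ.radius - γ.radius)) ^ 2 := by
    rw [hm, hw]; ring
  rw [Sphere.isIntTangent_iff_dist_center, Sphere.isExtTangent_iff_dist_center]
  refine ⟨⟨?_, p.le, hR.le⟩, ?_, p.le, hr.le⟩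
  · refine (sq_eq_sq₀ dist_nonneg hRk).1 ?_
    change dist (framePoint _ _ _ _) _ ^ 2 = _
    rw [ho]
    clear ho hi hRk hm p
    generalize porismCurvature Γ γ u = k at *
    generalize dist Γ.center γ.center = d at *
    generalize Γ.radius = R at *
    generalize γ.radius = r at *
    have hl : ((R * (R - 3 * r) - (R + r) * k⁻¹) / d - 0) ^ 2 + (√2 * w * k⁻¹ - 0) ^ 2 =
        ((R * (R - 3 * r) * k - (R + r)) ^ 2 + √2 ^ 2 * (d ^ 2 * w ^ 2)) / (d ^ 2 * k ^ 2) := by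
      field_simp
      ring
    rw [hl, s2, e1, div_eq_iff (by positivity), show (R - k⁻¹) ^ 2 * (d ^ 2 * k ^ 2) =
      (R * k - 1) ^ 2 * d ^ 2 by field_simp, hd2]
    ring
  · rw [← sq_eq_sq₀ dist_nonneg (by positivity)]
    change dist (framePoint _ _ _ _) _ ^ 2 = _
    rw [hi]
    simp only [porismCircle]
    clear ho hi hRk hm p
    generalize porismCurvature Γ γ u = k at *
    generalize dist Γ.center γ.center = d at *
    generalize Γ.radius = R at *
    generalize γ.radius = r at *
    have hl : ((R * (R - 3 * r) - (R + r) * k⁻¹) / d - d) ^ 2 + (√2 * w * k⁻¹ - 0) ^ 2 =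
        ((R * (R - 3 * r) * k - (R + r) - d ^ 2 * k) ^ 2 + √2 ^ 2 * (d ^ 2 * w ^ 2))
          / (d ^ 2 * k ^ 2) := by
      field_simp
      ring
    rw [hl, s2, e1, div_eq_iff (by positivity), show (k⁻¹ + r) ^ 2 * (d ^ 2 * k ^ 2) =
      (1 + k * r) ^ 2 * d ^ 2 by field_simp, hd2]
    ring

/-- Subtracting the equations for the distances R - s and r + s to the two parent centres makes the
abscissa affine in the radius s. The value of u is read off from the curvature 1/s and w from the
ordinate; either distance equation then becomes u² + w² = 1. -/
theorem exists_porismCircle_eq (h : IsParentPair Γ γ) {S : Sphere Plane} (hS : 0 < S.radius)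
    (ho : S.IsIntTangent Γ) (hi : S.IsExtTangent γ) :
    ∃ u w, u ^ 2 + w ^ 2 = 1 ∧ S = porismCircle Γ γ u w := by
  have hd := h.dist_pos
  have hd2 := h.dist_sq
  have hR := h.outer_pos
  have hr := h.radius_pos
  obtain ⟨x, y, hxy⟩ := exists_framePoint_eq h.center_ne S.center
  have h1 := framePoint_dist_sq h.center_ne x y 0 0
  have h2 := framePoint_dist_sq h.center_ne x y (dist Γ.center γ.center) 0
  rw [framePoint_zero_zero, hxy, ho.dist_center] at h1
  rw [framePoint_dist_zero h.center_ne, hxy, hi.dist_center] at h2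
  have hs2 : 0 < √2 := by positivity
  have s2 : √2 ^ 2 = 2 := Real.sq_sqrt (by norm_num)
  have hk : porismCurvature Γ γ ((2 * Γ.radius * γ.radius - (Γ.radius - γ.radius) * S.radius) /
      (dist Γ.center γ.center * S.radius)) = S.radius⁻¹ := by
    unfold porismCurvature
    field_simp
    ring
  have hx : dist Γ.center γ.center * x = Γ.radius * (Γ.radius - 3 * γ.radius)
      - (Γ.radius + γ.radius) * S.radius := by nlinarith
  refine ⟨(2 * Γ.radius * γ.radius - (Γ.radius - γ.radius) * S.radius) /
    (dist Γ.center γ.center * S.radius), y / (√2 * S.radius), ?_, ?_⟩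
  · have hy : dist Γ.center γ.center ^ 2 * y ^ 2 = dist Γ.center γ.center ^ 2 *
        (Γ.radius - S.radius) ^ 2 - (Γ.radius * (Γ.radius - 3 * γ.radius)
      - (Γ.radius + γ.radius) * S.radius) ^ 2 := by rw [← hx]; nlinarith
    rw [div_pow, div_pow, mul_pow, mul_pow, s2]
    field_simp
    rw [hy, hd2]
    ring
  · ext1
    · simp only [porismCircle, hk, inv_inv, ← hxy]
      rw [framePoint_inj h.center_ne]
      constructor
      · rw [← hx]; field_simp
      · field_simp
    · simp [porismCircle, hk]

end Circles

/-- The cosines of the angular parameters of the circles of a Steiner chain; `σ = ± 1` is the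
orientation. -/
def chainCos (u w σ : ℝ) : Fin 4 → ℝ := ![u, -(σ * w), -u, σ * w]

/-- The sines of the angular parameters of the circles of a Steiner chain. -/
def chainSin (u w σ : ℝ) : Fin 4 → ℝ := ![w, σ * u, -w, -(σ * u)]

/-- The Steiner chain of orientation `σ = ± 1` whose first circle has parameters `u`, `w`. -/
noncomputable def porismChain (Γ γ : Sphere Plane) (u w σ : ℝ) (i : Fin 4) : Sphere Plane :=
  porismCircle Γ γ (chainCos u w σ i) (chainSin u w σ i)

/-! ### Steiner chains as quarter turns; axi-symmetric and axial chains. -/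

section Chains

variable {Γ γ : Sphere Plane} {u w σ : ℝ}

theorem chainCos_sq_add_chainSin_sq (hu : u ^ 2 + w ^ 2 = 1) (hσ : σ ^ 2 = 1) (i : Fin 4) :
    chainCos u w σ i ^ 2 + chainSin u w σ i ^ 2 = 1 := by
  fin_cases i <;> simp [chainCos, chainSin, mul_pow, hσ] <;> linarith

theorem isSteinerChain_porismChain (h : IsParentPair Γ γ) (hu : u ^ 2 + w ^ 2 = 1)
    (hσ : σ ^ 2 = 1) : IsSteinerChain Γ γ (porismChain Γ γ u w σ) where
  radius_pos i := porismCircle_radius_pos h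
    (neg_one_le_of_sq_add_sq (chainCos_sq_add_chainSin_sq hu hσ i)) _
  injective i j hij := by
    have := (porismCircle_inj h
      (neg_one_le_of_sq_add_sq (chainCos_sq_add_chainSin_sq hu hσ i))).1 hij
    rcases sq_eq_one_iff.1 hσ with rfl | rfl
    all_goals
      fin_cases i <;> fin_cases j <;> simp [chainCos, chainSin] at this ⊢ <;> nlinarith
  outer i := (porismCircle_outer_inner h (chainCos_sq_add_chainSin_sq hu hσ i)).1
  inner i := (porismCircle_outer_inner h (chainCos_sq_add_chainSin_sq hu hσ i)).2
  adjacent i := by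
    refine (isExtTangent_porismCircle_iff h (chainCos_sq_add_chainSin_sq hu hσ i)
      (chainCos_sq_add_chainSin_sq hu hσ (i + 1))).2 ?_
    fin_cases i <;> simp [chainCos, chainSin] <;> ring

theorem exists_eq_rotate_of_orthogonal {u' w' : ℝ} (hu : u ^ 2 + w ^ 2 = 1)
    (hu' : u' ^ 2 + w' ^ 2 = 1) (ho : u * u' + w * w' = 0) :
    ∃ σ : ℝ, σ ^ 2 = 1 ∧ u' = -(σ * w) ∧ w' = σ * u := by
  refine ⟨u * w' - w * u', ?_, ?_, ?_⟩
  · linear_combination (u' ^ 2 + w' ^ 2) * hu + hu' - (u * u' + w * w') * ho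
  · linear_combination -u' * hu + u * ho
  · linear_combination -w' * hu + w * ho

/-- Tangency makes neighbouring angles differ by a quarter turn in one sense or the other, and
distinctness of the circles forces one sense throughout. -/
theorem isSteinerChain_iff (h : IsParentPair Γ γ) {C : Fin 4 → Sphere Plane} :
    IsSteinerChain Γ γ C ↔
      ∃ u w σ : ℝ, u ^ 2 + w ^ 2 = 1 ∧ σ ^ 2 = 1 ∧ C = porismChain Γ γ u w σ := by
  refine ⟨fun hC => ?_, fun ⟨u, w, σ, hu, hσ, e⟩ => e ▸ isSteinerChain_porismChain h hu hσ⟩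
  choose U W hUW hC' using fun i =>
    exists_porismCircle_eq h (hC.radius_pos i) (hC.outer i) (hC.inner i)
  have adj : ∀ i, U i * U (i + 1) + W i * W (i + 1) = 0 := fun i =>
    (isExtTangent_porismCircle_iff h (hUW i) (hUW (i + 1))).1
      (hC' i ▸ hC' (i + 1) ▸ hC.adjacent i)
  have inj : ∀ i j, i ≠ j → ¬ (U i = U j ∧ W i = W j) := by
    rintro i j hij ⟨e, e'⟩
    exact hij (hC.injective (by rw [hC' i, hC' j, e, e']))
  obtain ⟨σ, hσ, hU1, hW1⟩ := exists_eq_rotate_of_orthogonal (hUW 0) (hUW 1) (adj 0)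
  obtain ⟨τ, hτ, hU2, hW2⟩ := exists_eq_rotate_of_orthogonal (hUW 1) (hUW 2) (adj 1)
  obtain ⟨ρ, hρ, hU3, hW3⟩ := exists_eq_rotate_of_orthogonal (hUW 0) (hUW 3)
    (by linarith [show U 3 * U 0 + W 3 * W 0 = 0 from adj 3])
  have i02 := inj 0 2 (by decide)
  have i13 := inj 1 3 (by decide)
  -- Equal signs would make the second and fourth circles coincide.
  have hρσ : ρ = -σ := (sq_eq_sq_iff_eq_or_eq_neg.1 (hρ.trans hσ.symm)).resolve_left fun e =>
    i13 ⟨by rw [hU1, hU3, e], by rw [hW1, hW3, e]⟩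
  -- Turning back would make the third circle equal to the first.
  have hτσ : τ = σ := (sq_eq_sq_iff_eq_or_eq_neg.1 (hτ.trans hσ.symm)).resolve_right fun e =>
    i02 ⟨by rw [hU2, hW1, e]; linear_combination -U 0 * hσ,
      by rw [hW2, hU1, e]; linear_combination -W 0 * hσ⟩
  have hU2' : U 2 = -U 0 := by rw [hU2, hW1, hτσ]; linear_combination -U 0 * hσ
  have hW2' : W 2 = -W 0 := by rw [hW2, hU1, hτσ]; linear_combination -W 0 * hσ
  refine ⟨U 0, W 0, σ, hUW 0, hσ, ?_⟩
  funext i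
  rw [hC' i, porismChain]
  fin_cases i
  · rfl
  · simp [chainCos, chainSin, hU1, hW1]
  · simp [chainCos, chainSin, hU2', hW2']
  · simp [chainCos, chainSin, hU3, hW3, hρσ]

theorem reflection_porismCircle_center (h : IsParentPair Γ γ) :
    reflection (porismAxis Γ γ) (porismCircle Γ γ u w).center =
      (porismCircle Γ γ u (-w)).center := by
  simp [porismCircle, reflection_framePoint Γ γ h.center_ne]

theorem isAxiSymmetric_porismChain_iff (h : IsParentPair Γ γ) (hu : u ^ 2 + w ^ 2 = 1)
    (hσ : σ ^ 2 = 1) :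
    IsAxiSymmetric Γ γ (porismChain Γ γ u w σ) ↔ u * w = 0 ∨ u ^ 2 = w ^ 2 := by
  have key : IsAxiSymmetric Γ γ (porismChain Γ γ u w σ) ↔ ∀ i, ∃ j,
      chainCos u w σ j = chainCos u w σ i ∧ chainSin u w σ j = -chainSin u w σ i := by
    refine forall_congr' fun i => exists_congr fun j => ?_
    rw [porismChain, porismChain, reflection_porismCircle_center h, ← porismCircle_inj h
      (neg_one_le_of_sq_add_sq (chainCos_sq_add_chainSin_sq hu hσ j)), Sphere.ext_iff]
    rfl
  rw [key]
  constructor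
  · intro H
    -- The mirror image of the first circle alone decides: it is the circle itself (w = 0), the
    -- opposite one (u = 0) or a neighbour (u = ±w).
    obtain ⟨j, hj⟩ := H 0
    rcases sq_eq_one_iff.1 hσ with rfl | rfl
    all_goals
      fin_cases j <;> simp [chainCos, chainSin] at hj
      · left; rw [show w = 0 by linarith, mul_zero]
      · right; simp [← hj.1]
      · left; rw [show u = 0 by linarith, zero_mul]
      · right; simp [← hj.1]
  · rintro H i
    have : w = 0 ∨ u = 0 ∨ w = σ * u ∨ w = -(σ * u) := by
      rcases H with H | H
      · rcases mul_eq_zero.1 H with H | H <;> simp [H]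
      · refine .inr (.inr (sq_eq_sq_iff_eq_or_eq_neg.1 ?_))
        rw [mul_pow, hσ, ← H, one_mul]
    have hσ' : ∀ x, σ * (σ * x) = x := fun x => by linear_combination x * hσ
    rcases this with e | e | e | e
    -- In each case the mirror acts on the cycle of labels as a reflection of a square: through two
    -- opposite vertices here and in the next case, through midpoints of opposite sides in the last
    -- two.
    · refine ⟨![0, 3, 2, 1] i, ?_⟩
      fin_cases i <;> simp [chainCos, chainSin, e]
    · refine ⟨![2, 1, 0, 3] i, ?_⟩
      fin_cases i <;> simp [chainCos, chainSin, e]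
    · refine ⟨![3, 2, 1, 0] i, ?_⟩
      fin_cases i <;> simp [chainCos, chainSin, e, hσ']
    · refine ⟨![1, 0, 3, 2] i, ?_⟩
      fin_cases i <;> simp [chainCos, chainSin, e, hσ']

theorem porismCurvature_strictMono (h : IsParentPair Γ γ) : StrictMono (porismCurvature Γ γ) := by
  intro x y hxy
  have := mul_pos h.outer_pos h.radius_pos
  exact div_lt_div_of_pos_right (by nlinarith [h.dist_pos]) (by linarith)

/-- Every tangent circle starts a chain, so all cosines in [-1, 1] occur and the extreme radii
belong to u = ±1. -/
theorem mem_poristicRadii_iff (h : IsParentPair Γ γ) {ρ : ℝ} :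
    ρ ∈ poristicRadii Γ γ ↔ ∃ u, -1 ≤ u ∧ u ≤ 1 ∧ (porismCurvature Γ γ u)⁻¹ = ρ := by
  constructor
  · rintro ⟨C, hC, i, hi⟩
    obtain ⟨u, w, σ, hu, hσ, rfl⟩ := (isSteinerChain_iff h).1 hC
    have := chainCos_sq_add_chainSin_sq hu hσ i
    exact ⟨_, neg_one_le_of_sq_add_sq this, le_one_of_sq_add_sq this, hi⟩
  · rintro ⟨u, h1, h2, hρ⟩
    have hu : u ^ 2 + √(1 - u ^ 2) ^ 2 = 1 := by
      rw [Real.sq_sqrt (by nlinarith)]; ring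
    exact ⟨_, isSteinerChain_porismChain h hu (one_pow 2), 0, hρ⟩

theorem isGreatest_poristicRadii (h : IsParentPair Γ γ) :
    IsGreatest (poristicRadii Γ γ) (porismCurvature Γ γ (-1))⁻¹ := by
  refine ⟨(mem_poristicRadii_iff h).2 ⟨-1, le_rfl, by norm_num, rfl⟩, ?_⟩
  rintro ρ hρ
  obtain ⟨u, h1, -, rfl⟩ := (mem_poristicRadii_iff h).1 hρ
  exact inv_anti₀ (porismCurvature_pos h le_rfl) ((porismCurvature_strictMono h).monotone h1)

theorem isLeast_poristicRadii (h : IsParentPair Γ γ) :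
    IsLeast (poristicRadii Γ γ) (porismCurvature Γ γ 1)⁻¹ := by
  refine ⟨(mem_poristicRadii_iff h).2 ⟨1, by norm_num, le_rfl, rfl⟩, ?_⟩
  rintro ρ hρ
  obtain ⟨u, h1, h2, rfl⟩ := (mem_poristicRadii_iff h).1 hρ
  exact inv_anti₀ (porismCurvature_pos h h1) ((porismCurvature_strictMono h).monotone h2)

theorem isAxialChain_porismChain_iff (h : IsParentPair Γ γ) (hu : u ^ 2 + w ^ 2 = 1)
    (hσ : σ ^ 2 = 1) : IsAxialChain Γ γ (porismChain Γ γ u w σ) ↔ u * w = 0 := by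
  have big : (∃ i, IsGreatest (poristicRadii Γ γ) (porismChain Γ γ u w σ i).radius) ↔
      ∃ i, chainCos u w σ i = -1 := by
    refine exists_congr fun i => ⟨fun hi => ?_, fun hi => ?_⟩
    · exact (porismCurvature_inj h).1 (inv_injective (hi.unique (isGreatest_poristicRadii h)))
    · have := isGreatest_poristicRadii h
      rwa [← hi] at this
  have small : (∃ i, IsLeast (poristicRadii Γ γ) (porismChain Γ γ u w σ i).radius) ↔
      ∃ i, chainCos u w σ i = 1 := by
    refine exists_congr fun i => ⟨fun hi => ?_, fun hi => ?_⟩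
    · exact (porismCurvature_inj h).1 (inv_injective (hi.unique (isLeast_poristicRadii h)))
    · have := isLeast_poristicRadii h
      rwa [← hi] at this
  constructor
  · intro H
    obtain ⟨i, hi⟩ := big.1 H.biggest
    have hs := chainCos_sq_add_chainSin_sq hu hσ i
    rw [hi] at hs
    have hz : chainSin u w σ i = 0 := pow_eq_zero_iff two_ne_zero |>.1 (by linarith)
    have hσ0 : σ ≠ 0 := by rintro rfl; norm_num at hσ
    fin_cases i <;> simp [chainSin, hσ0] at hz <;> simp [hz]
  · intro H
    refine ⟨isSteinerChain_porismChain h hu hσ, big.2 ?_, small.2 ?_⟩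
    all_goals
      simp only [Fin.exists_fin_succ, Fin.exists_fin_zero]
      simp only [chainCos]
      rcases sq_eq_one_iff.1 hσ with rfl | rfl <;> rcases mul_eq_zero.1 H with rfl | rfl
      all_goals
        simp at hu
        rcases hu with rfl | rfl <;> simp

theorem mem_porismCircle_iff (h : IsParentPair Γ γ) (hu : -1 ≤ u) {x y : ℝ} :
    framePoint Γ.center γ.center x y ∈ porismCircle Γ γ u w ↔
      (x - (Γ.radius * (Γ.radius - 3 * γ.radius)
      - (Γ.radius + γ.radius) * (porismCurvature Γ γ u)⁻¹) / dist Γ.center γ.center) ^ 2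
      + (y - √2 * w * (porismCurvature Γ γ u)⁻¹) ^ 2 = (porismCurvature Γ γ u)⁻¹ ^ 2 := by
  rw [mem_sphere, ← sq_eq_sq₀ dist_nonneg (porismCircle_radius_pos h hu w).le,
    ← framePoint_dist_sq h.center_ne]
  rfl

end Chains

/-! ### Lateral chains, and uniqueness up to labelling. -/

section Lateral

variable {Γ γ : Sphere Plane} {u w σ : ℝ}

/-- The first coordinate of the centre of the circle with angular parameter of cosine `u`. -/
noncomputable def porismAbscissa (Γ γ : Sphere Plane) (u : ℝ) : ℝ :=
  (Γ.radius * (Γ.radius - 3 * γ.radius)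
    - (Γ.radius + γ.radius) * (porismCurvature Γ γ u)⁻¹) / dist Γ.center γ.center

theorem porismAbscissa_inj (h : IsParentPair Γ γ) {u u' : ℝ} :
    porismAbscissa Γ γ u = porismAbscissa Γ γ u' ↔ u = u' := by
  refine ⟨fun e => ?_, fun e => by rw [e]⟩
  have h1 := (div_left_inj' h.dist_pos.ne').1 e
  have h2 := mul_left_cancel₀ (add_pos h.outer_pos h.radius_pos).ne' (sub_right_injective h1)
  exact (porismCurvature_inj h).1 (inv_injective h2)

/-- When 2w² = 1 the distance √2 |w| s from the centre to the axis equals the radius s, so the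
circle meets the axis only at the foot of the perpendicular from its centre. -/
theorem axis_mem_porismCircle_iff (h : IsParentPair Γ γ) (hu : -1 ≤ u) (hw : 2 * w ^ 2 = 1)
    {x : ℝ} : framePoint Γ.center γ.center x 0 ∈ porismCircle Γ γ u w ↔
      x = porismAbscissa Γ γ u := by
  rw [mem_porismCircle_iff h hu, ← sub_eq_zero (b := porismAbscissa Γ γ u),
    ← sq_eq_zero_iff (a := x - _)]
  have s2 : √2 ^ 2 = 2 := Real.sq_sqrt (by norm_num)
  have : (0 - √2 * w * (porismCurvature Γ γ u)⁻¹) ^ 2 = (porismCurvature Γ γ u)⁻¹ ^ 2 := by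
    linear_combination (w * (porismCurvature Γ γ u)⁻¹) ^ 2 * s2
      + (porismCurvature Γ γ u)⁻¹ ^ 2 * hw
  rw [this, add_eq_right]
  rfl

theorem chainCos_of_sq_eq (hw : u ^ 2 = w ^ 2) (hσ : σ ^ 2 = 1) (i : Fin 4) :
    chainCos u w σ i = u ∨ chainCos u w σ i = -u := by
  rw [← sq_eq_sq_iff_eq_or_eq_neg]
  fin_cases i <;> simp [chainCos, mul_pow, hσ, hw]

theorem isLateralChain_porismChain_iff (h : IsParentPair Γ γ) (hu : u ^ 2 + w ^ 2 = 1)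
    (hσ : σ ^ 2 = 1) : IsLateralChain Γ γ (porismChain Γ γ u w σ) ↔ u ^ 2 = w ^ 2 := by
  constructor
  · intro H
    refine ((isAxiSymmetric_porismChain_iff h hu hσ).1 H.symmetric).resolve_left fun h0 => ?_
    obtain ⟨i, hi⟩ : ∃ i, chainSin u w σ i = 0 := by
      rcases mul_eq_zero.1 h0 with e | e
      · exact ⟨1, by simp [chainSin, e]⟩
      · exact ⟨0, by simp [chainSin, e]⟩
    have hc := neg_one_le_of_sq_add_sq (chainCos_sq_add_chainSin_sq hu hσ i)
    set x := porismAbscissa Γ γ (chainCos u w σ i) with hx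
    set ρ := (porismCurvature Γ γ (chainCos u w σ i))⁻¹ with hρ
    have hρ0 : 0 < ρ := inv_pos.2 (porismCurvature_pos h hc)
    have hcen : (porismChain Γ γ u w σ i).center = framePoint Γ.center γ.center x 0 := by
      simp [porismChain, porismCircle, hi, hx, porismAbscissa]
    -- If uw = 0, some circle is centred on the axis. At this crossing point its radius runs along
    -- the axis, so the axis is not tangent there.
    have hmem : framePoint Γ.center γ.center (x + ρ) 0 ∈ porismChain Γ γ u w σ i := by
      rw [porismChain, mem_porismCircle_iff h hc, ← hρ, hi]
      change (x + ρ - x) ^ 2 + _ = _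
      ring
    have ht := (H.tangent i _ ((framePoint_mem_line_iff h.center_ne).2 rfl)
      hmem).inner_left_eq_zero_of_mem
      (x := framePoint Γ.center γ.center x 0) ((framePoint_mem_line_iff h.center_ne).2 rfl)
    rw [hcen, framePoint_inner h.center_ne] at ht
    nlinarith
  · intro H
    have hs : ∀ i, 2 * chainSin u w σ i ^ 2 = 1 := by
      intro i
      fin_cases i <;> simp [chainSin, mul_pow, hσ] <;> linarith
    have hc : ∀ i, -1 ≤ chainCos u w σ i := fun i =>
      neg_one_le_of_sq_add_sq (chainCos_sq_add_chainSin_sq hu hσ i)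
    have hmem : ∀ i x, framePoint Γ.center γ.center x 0 ∈ porismChain Γ γ u w σ i ↔
      x = porismAbscissa Γ γ (chainCos u w σ i) := fun i x =>
        axis_mem_porismCircle_iff h (hc i) (hs i)
    refine ⟨isSteinerChain_porismChain h hu hσ, (isAxiSymmetric_porismChain_iff h hu hσ).2
      (.inr H), ?_, ?_⟩
    · have hset : {p : Plane | p ∈ porismAxis Γ γ ∧ ∃ i, p ∈ porismChain Γ γ u w σ i} =
          {framePoint Γ.center γ.center (porismAbscissa Γ γ u) 0,
            framePoint Γ.center γ.center (porismAbscissa Γ γ (-u)) 0} := by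
        ext p
        obtain ⟨x, y, rfl⟩ := exists_framePoint_eq h.center_ne p
        simp only [Set.mem_ofPred_eq, porismAxis, framePoint_mem_line_iff h.center_ne,
          Set.mem_insert_iff, Set.mem_singleton_iff, framePoint_inj h.center_ne]
        constructor
        · rintro ⟨rfl, i, hi⟩
          rw [hmem] at hi
          rcases chainCos_of_sq_eq H hσ i with e | e <;> rw [e] at hi <;> simp [hi]
        · rintro (⟨rfl, rfl⟩ | ⟨rfl, rfl⟩)
          · exact ⟨rfl, 0, (hmem 0 _).2 rfl⟩
          · exact ⟨rfl, 2, (hmem 2 _).2 rfl⟩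
      rw [hset, Set.ncard_pair]
      rw [Ne, framePoint_inj h.center_ne, porismAbscissa_inj h]
      rintro ⟨e, -⟩
      have : u = 0 := by linarith
      rw [this] at hu H
      linarith
    · intro i p hp hpi
      refine ⟨hpi, hp, ?_⟩
      intro q hq
      obtain ⟨x, y, rfl⟩ := exists_framePoint_eq h.center_ne p
      obtain ⟨x', y', rfl⟩ := exists_framePoint_eq h.center_ne q
      obtain rfl := (framePoint_mem_line_iff h.center_ne).1 hp
      obtain rfl := (framePoint_mem_line_iff h.center_ne).1 hq
      have hx := (hmem i x).1 hpi
      rw [Sphere.mem_orthRadius_iff_inner_left]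
      change inner ℝ _ (_ -ᵥ framePoint _ _ (porismAbscissa Γ γ (chainCos u w σ i)) _) = 0
      rw [framePoint_inner h.center_ne, ← hx]
      ring

/-- Reversing the orientation only exchanges the second and fourth circles. -/
theorem range_porismChain (hσ : σ ^ 2 = 1) : Set.range (porismChain Γ γ u w σ) =
    {porismCircle Γ γ u w, porismCircle Γ γ (-w) u, porismCircle Γ γ (-u) (-w),
      porismCircle Γ γ w (-u)} := by
  ext S
  simp only [Set.mem_range, Fin.exists_fin_succ, Fin.exists_fin_zero, porismChain, chainCos,
    chainSin, Set.mem_insert_iff, Set.mem_singleton_iff]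
  rcases sq_eq_one_iff.1 hσ with rfl | rfl
  · simp [eq_comm (a := S)]
  · simp [eq_comm (a := S)]
    tauto

theorem range_porismChain_axial (hu : u ^ 2 + w ^ 2 = 1) (hσ : σ ^ 2 = 1) (h0 : u * w = 0) :
    Set.range (porismChain Γ γ u w σ) = Set.range (porismChain Γ γ 1 0 1) := by
  rw [range_porismChain hσ, range_porismChain (one_pow 2)]
  rcases mul_eq_zero.1 h0 with rfl | rfl
  all_goals
    simp at hu
    ext S
    rcases hu with rfl | rfl <;> simp <;> tauto

/-- Here `√2⁻¹` is the square root of 1/2. -/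
theorem eq_or_eq_neg_of_sq_eq (hu : u ^ 2 + w ^ 2 = 1) (h0 : u ^ 2 = w ^ 2) :
    u = √2⁻¹ ∨ u = -√2⁻¹ := by
  rw [← sq_eq_sq_iff_eq_or_eq_neg, Real.sq_sqrt (by norm_num)]
  linarith

theorem range_porismChain_lateral (hu : u ^ 2 + w ^ 2 = 1) (hσ : σ ^ 2 = 1) (h0 : u ^ 2 = w ^ 2) :
    Set.range (porismChain Γ γ u w σ) = Set.range (porismChain Γ γ √2⁻¹ √2⁻¹ 1) := by
  rw [range_porismChain hσ, range_porismChain (one_pow 2)]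
  have hw := eq_or_eq_neg_of_sq_eq ((add_comm _ _).trans hu) h0.symm
  ext S
  rcases eq_or_eq_neg_of_sq_eq hu h0 with rfl | rfl <;> rcases hw with rfl | rfl <;>
    simp only [neg_neg, Set.mem_insert_iff, Set.mem_singleton_iff] <;> tauto

end Lateral

/-! ### The area as a decreasing function of p = u²w². -/

section Area

variable {Γ γ : Sphere Plane} {u w σ : ℝ}

theorem chainArea_eq {C : Fin 4 → Sphere Plane} (hC : ∀ i, 0 ≤ (C i).radius) :
    chainArea C = Real.pi * ∑ i, (C i).radius ^ 2 := by
  rw [chainArea, Finset.mul_sum]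
  refine Finset.sum_congr rfl fun i _ => ?_
  rw [Measure.real, EuclideanSpace.volume_closedBall_fin_two, ENNReal.toReal_mul,
    ENNReal.toReal_pow, ENNReal.toReal_ofReal (hC i), ENNReal.toReal_ofReal Real.pi_pos.le,
    mul_comm]

/-- The area of the chains whose first circle has parameters `u`, `w` with `u ^ 2 * w ^ 2 = p`. -/
noncomputable def porismArea (Γ γ : Sphere Plane) (p : ℝ) : ℝ :=
  let e := (Γ.radius - γ.radius) ^ 2
  let S := (Γ.radius + γ.radius) ^ 2
  let X := 4 * e * Γ.radius * γ.radius + dist Γ.center γ.center ^ 4 * p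
  Real.pi * (4 * Γ.radius ^ 2 * γ.radius ^ 2) * (4 * e * S ^ 2 / X ^ 2 - (8 * e + 2 * S) / X)

/-- Let nᵢ be the curvatures times 2Rr. Opposite ones have sum 2(R - r); if P and Q are the products
of the two opposite pairs, the closure relation gives P + Q = (R + r)² and PQ = X. The sum of the
1/nᵢ² is symmetric in P and Q, hence a function of X alone. -/
theorem chainArea_porismChain (h : IsParentPair Γ γ) (hu : u ^ 2 + w ^ 2 = 1) (hσ : σ ^ 2 = 1) :
    chainArea (porismChain Γ γ u w σ) = porismArea Γ γ (u ^ 2 * w ^ 2) := by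
  have hC := isSteinerChain_porismChain h hu hσ
  have hpos : ∀ x : ℝ, x ^ 2 ≤ 1 → 0 < Γ.radius - γ.radius + dist Γ.center γ.center * x := by
    intro x hx
    have : -1 ≤ x := by nlinarith
    nlinarith [h.dist_pos, h.dist_lt]
  have p1 := hpos u (by nlinarith)
  have p2 := hpos (-u) (by nlinarith)
  have p3 := hpos w (by nlinarith)
  have p4 := hpos (-w) (by nlinarith)
  have hsum : ∑ i, (porismChain Γ γ u w σ i).radius ^ 2 = (porismCurvature Γ γ u)⁻¹ ^ 2 +
      (porismCurvature Γ γ (-u))⁻¹ ^ 2 + (porismCurvature Γ γ w)⁻¹ ^ 2 +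
      (porismCurvature Γ γ (-w))⁻¹ ^ 2 := by
    simp only [Fin.sum_univ_four, porismChain, chainCos, porismCircle]
    rcases sq_eq_one_iff.1 hσ with rfl | rfl <;> simp <;> ring
  rw [chainArea_eq fun i => (hC.radius_pos i).le, hsum]
  have hR := h.outer_pos.ne'
  have hr := h.radius_pos.ne'
  have hd2 := h.dist_sq
  unfold porismArea porismCurvature
  generalize dist Γ.center γ.center = d at *
  generalize Γ.radius = R at *
  generalize γ.radius = r at *
  have hX : 4 * (R - r) ^ 2 * R * r + d ^ 4 * (u ^ 2 * w ^ 2) =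
      (R - r + d * u) * (R - r + d * (-u)) * ((R - r + d * w) * (R - r + d * (-w))) := by
    linear_combination (R - r) ^ 2 * hd2 + (R - r) ^ 2 * d ^ 2 * hu
  have hS : (R + r) ^ 2 = (R - r + d * u) * (R - r + d * (-u))
      + (R - r + d * w) * (R - r + d * (-w)) := by
    linear_combination hd2 + d ^ 2 * hu
  dsimp only
  rw [hX, hS]
  generalize h1 : R - r + d * u = k1 at *
  generalize h2 : R - r + d * (-u) = k2 at *
  generalize h3 : R - r + d * w = k3 at *
  generalize h4 : R - r + d * (-w) = k4 at *
  have e1 : k2 = 2 * (R - r) - k1 := by linarith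
  have e2 : k4 = 2 * (R - r) - k3 := by linarith
  generalize R - r = e at *
  field_simp
  subst e1 e2
  ring

theorem porismArea_strictAnti (h : IsParentPair Γ γ) {p q : ℝ} (hp : 0 ≤ p) (hpq : p < q)
    (hq : q ≤ 1 / 4) : porismArea Γ γ q < porismArea Γ γ p := by
  have hR := h.outer_pos
  have hr := h.radius_pos
  have hlt := h.radius_lt
  have hd := h.dist_pos
  have hd2 := h.dist_sq
  unfold porismArea
  dsimp only
  generalize dist Γ.center γ.center = d at *
  generalize Γ.radius = R at *
  generalize γ.radius = r at *
  have hd4 : d ^ 4 = (R ^ 2 - 6 * R * r + r ^ 2) ^ 2 := by rw [← hd2]; ring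
  have hd4' : 0 < d ^ 4 := by positivity
  have he : 0 < R - r := by linarith
  have hX0 : 0 < 4 * (R - r) ^ 2 * R * r + d ^ 4 * p := by positivity
  have hXlt : 4 * (R - r) ^ 2 * R * r + d ^ 4 * p < 4 * (R - r) ^ 2 * R * r + d ^ 4 * q := by
    gcongr
  -- This is PQ ≤ (P + Q)²/4 for the two pair products, with equality at q = 1/4.
  have hYS : 4 * (R - r) ^ 2 * R * r + d ^ 4 * q ≤ ((R + r) ^ 2) ^ 2 / 4 := by
    have : d ^ 4 * q ≤ d ^ 4 * (1 / 4) := by gcongr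
    have e : 4 * (R - r) ^ 2 * R * r + d ^ 4 * (1 / 4) = ((R + r) ^ 2) ^ 2 / 4 := by
      rw [hd4]; ring
    linarith
  -- The difference of the two sides is d².
  have hSe : (R + r) ^ 2 ≤ 2 * (R - r) ^ 2 := by nlinarith [sq_nonneg d]
  have hE : 0 < (R - r) ^ 2 := by positivity
  have hS : 0 < (R + r) ^ 2 := by positivity
  generalize 4 * (R - r) ^ 2 * R * r + d ^ 4 * p = X at *
  generalize 4 * (R - r) ^ 2 * R * r + d ^ 4 * q = Y at *
  generalize (R - r) ^ 2 = e at *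
  generalize (R + r) ^ 2 = S at *
  refine mul_lt_mul_of_pos_left ?_ (by positivity)
  have hY0 : 0 < Y := hX0.trans hXlt
  have key : 4 * e * S ^ 2 / X ^ 2 - (8 * e + 2 * S) / X - (4 * e * S ^ 2 / Y ^ 2
      - (8 * e + 2 * S) / Y) =
      (Y - X) * (4 * e * S ^ 2 * (X + Y) - (8 * e + 2 * S) * X * Y) / (X ^ 2 * Y ^ 2) := by
    field_simp
    ring
  -- With S ≤ 2e and Y ≤ S²/4 the left side is at most 3eS²X, which leaves room to spare.
  have : (8 * e + 2 * S) * X * Y < 4 * e * S ^ 2 * (X + Y) := by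
    have t1 : (8 * e + 2 * S) * X * Y ≤ (12 * e) * X * (S ^ 2 / 4) := by
      gcongr
      linarith
    have t2 : 0 < e * S ^ 2 * X := by positivity
    have t3 : 0 < e * S ^ 2 * Y := by positivity
    linarith
  rw [← sub_pos, key]
  exact div_pos (mul_pos (by linarith) (by linarith)) (by positivity)

theorem porismArea_zero (h : IsParentPair Γ γ) {a A : ℝ} (ha : a = 1 / γ.radius)
    (hA : A = -(1 / Γ.radius)) : porismArea Γ γ 0 =
      (A ^ 4 + 6 * A ^ 3 * a + 18 * A ^ 2 * a ^ 2 + 6 * A * a ^ 3 + a ^ 4) /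
        (A ^ 2 * a ^ 2 * (a + A) ^ 2) * Real.pi := by
  have hR := h.outer_pos.ne'
  have hr := h.radius_pos.ne'
  have he : Γ.radius - γ.radius ≠ 0 := (sub_pos.2 h.radius_lt).ne'
  have e : a + A = (Γ.radius - γ.radius) / (Γ.radius * γ.radius) := by
    rw [ha, hA]; field_simp; ring
  rw [e, ha, hA]
  simp only [porismArea]
  generalize Γ.radius = R at *
  generalize γ.radius = r at *
  rw [mul_zero, add_zero]
  field_simp
  ring

theorem porismArea_quarter (h : IsParentPair Γ γ) {a A : ℝ} (ha : a = 1 / γ.radius)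
    (hA : A = -(1 / Γ.radius)) : porismArea Γ γ (1 / 4) =
      32 * (3 * a + A) * (a + 3 * A) / (a - A) ^ 4 * Real.pi := by
  have hR := h.outer_pos.ne'
  have hr := h.radius_pos.ne'
  have he : Γ.radius + γ.radius ≠ 0 := (add_pos h.outer_pos h.radius_pos).ne'
  have hd2 := h.dist_sq
  have e : a - A = (Γ.radius + γ.radius) / (Γ.radius * γ.radius) := by
    rw [ha, hA]; field_simp; ring
  rw [e, ha, hA]
  simp only [porismArea]
  generalize dist Γ.center γ.center = d at *
  generalize Γ.radius = R at *
  generalize γ.radius = r at *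
  have hX : 4 * (R - r) ^ 2 * R * r + d ^ 4 * (1 / 4) = (R + r) ^ 4 / 4 := by
    rw [show d ^ 4 = (d ^ 2) ^ 2 by ring, hd2]; ring
  rw [hX]
  field_simp
  ring

end Area

/-! ### Global and local extrema of the area. -/

section Extrema

open Filter Topology

variable {Γ γ : Sphere Plane} {u w σ : ℝ}

theorem sq_mul_sq_le_quarter (hu : u ^ 2 + w ^ 2 = 1) : u ^ 2 * w ^ 2 ≤ 1 / 4 := by
  nlinarith [sq_nonneg (u ^ 2 - w ^ 2)]

theorem sq_mul_sq_eq_quarter_iff (hu : u ^ 2 + w ^ 2 = 1) :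
    u ^ 2 * w ^ 2 = 1 / 4 ↔ u ^ 2 = w ^ 2 := by
  rw [← sub_eq_zero (a := u ^ 2), ← sq_eq_zero_iff (a := _ - _)]
  constructor <;> intro e <;> nlinarith

theorem porismArea_le_iff (h : IsParentPair Γ γ) {p q : ℝ} (hp : 0 ≤ p) (hp' : p ≤ 1 / 4)
    (hq : 0 ≤ q) (hq' : q ≤ 1 / 4) : porismArea Γ γ p ≤ porismArea Γ γ q ↔ q ≤ p := by
  rcases lt_trichotomy p q with e | e | e
  · exact iff_of_false (porismArea_strictAnti h hp e hq').not_ge e.not_ge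
  · simp [e]
  · exact iff_of_true (porismArea_strictAnti h hq e hp').le e.le

theorem porismArea_inj (h : IsParentPair Γ γ) {p q : ℝ} (hp : 0 ≤ p) (hp' : p ≤ 1 / 4)
    (hq : 0 ≤ q) (hq' : q ≤ 1 / 4) : porismArea Γ γ p = porismArea Γ γ q ↔ p = q := by
  rw [le_antisymm_iff, porismArea_le_iff h hp hp' hq hq', porismArea_le_iff h hq hq' hp hp',
    le_antisymm_iff, and_comm]

theorem chainArea_eq_max_iff (h : IsParentPair Γ γ) {C : Fin 4 → Sphere Plane}
    (hC : IsSteinerChain Γ γ C) : chainArea C = porismArea Γ γ 0 ↔ IsAxialChain Γ γ C := by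
  obtain ⟨u, w, σ, hu, hσ, rfl⟩ := (isSteinerChain_iff h).1 hC
  rw [chainArea_porismChain h hu hσ, isAxialChain_porismChain_iff h hu hσ,
    porismArea_inj h (by positivity) (sq_mul_sq_le_quarter hu) le_rfl (by norm_num),
    ← mul_pow, sq_eq_zero_iff]

theorem chainArea_eq_min_iff (h : IsParentPair Γ γ) {C : Fin 4 → Sphere Plane}
    (hC : IsSteinerChain Γ γ C) :
    chainArea C = porismArea Γ γ (1 / 4) ↔ IsLateralChain Γ γ C := by
  obtain ⟨u, w, σ, hu, hσ, rfl⟩ := (isSteinerChain_iff h).1 hC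
  rw [chainArea_porismChain h hu hσ, isLateralChain_porismChain_iff h hu hσ,
    porismArea_inj h (by positivity) (sq_mul_sq_le_quarter hu) (by norm_num) le_rfl,
    sq_mul_sq_eq_quarter_iff hu]

theorem chainArea_le_max (h : IsParentPair Γ γ) {C : Fin 4 → Sphere Plane}
    (hC : IsSteinerChain Γ γ C) : chainArea C ≤ porismArea Γ γ 0 := by
  obtain ⟨u, w, σ, hu, hσ, rfl⟩ := (isSteinerChain_iff h).1 hC
  rw [chainArea_porismChain h hu hσ,
    porismArea_le_iff h (by positivity) (sq_mul_sq_le_quarter hu) le_rfl (by norm_num)]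
  positivity

theorem min_le_chainArea (h : IsParentPair Γ γ) {C : Fin 4 → Sphere Plane}
    (hC : IsSteinerChain Γ γ C) : porismArea Γ γ (1 / 4) ≤ chainArea C := by
  obtain ⟨u, w, σ, hu, hσ, rfl⟩ := (isSteinerChain_iff h).1 hC
  rw [chainArea_porismChain h hu hσ,
    porismArea_le_iff h (by norm_num) le_rfl (by positivity) (sq_mul_sq_le_quarter hu)]
  exact sq_mul_sq_le_quarter hu

theorem isAxialChain_porismChain_one_zero (h : IsParentPair Γ γ) :
    IsAxialChain Γ γ (porismChain Γ γ 1 0 1) :=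
  (isAxialChain_porismChain_iff h (by norm_num) (by norm_num)).2 (by norm_num)

theorem two_mul_sqrt_half_sq : √2⁻¹ ^ 2 + √2⁻¹ ^ 2 = 1 := by
  rw [Real.sq_sqrt (by norm_num)]
  norm_num

theorem isLateralChain_porismChain_sqrt_half (h : IsParentPair Γ γ) :
    IsLateralChain Γ γ (porismChain Γ γ √2⁻¹ √2⁻¹ 1) :=
  (isLateralChain_porismChain_iff h two_mul_sqrt_half_sq (by norm_num)).2 rfl

theorem exists_cos_sin_eq (hu : u ^ 2 + w ^ 2 = 1) : ∃ θ : ℝ, u = Real.cos θ ∧ w = Real.sin θ := by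
  have hn : ‖(⟨u, w⟩ : ℂ)‖ = 1 := by
    rw [← sq_eq_sq₀ (norm_nonneg _) zero_le_one, ← Complex.normSq_eq_norm_sq, Complex.normSq_mk]
    linarith
  refine ⟨Complex.arg ⟨u, w⟩, ?_, ?_⟩
  · simpa [hn] using (Complex.norm_mul_cos_arg ⟨u, w⟩).symm
  · simpa [hn] using (Complex.norm_mul_sin_arg ⟨u, w⟩).symm

/-- Supplies the admissible variations: moving θ at fixed orientation stays inside any
ε-neighbourhood, so a local extremum of the area is a local extremum in θ. -/
theorem eventually_chainsClose (h : IsParentPair Γ γ) (hσ : σ ^ 2 = 1) (θ₀ : ℝ) {ε : ℝ}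
    (hε : 0 < ε) : ∀ᶠ θ in 𝓝 θ₀,
      ChainsClose ε (porismChain Γ γ (Real.cos θ₀) (Real.sin θ₀) σ)
        (porismChain Γ γ (Real.cos θ) (Real.sin θ) σ) := by
  refine eventually_all.2 fun i => ?_
  have hcos : Continuous fun θ => chainCos (Real.cos θ) (Real.sin θ) σ i := by
    fin_cases i <;> simp only [chainCos] <;> simp <;> fun_prop
  have hsin : Continuous fun θ => chainSin (Real.cos θ) (Real.sin θ) σ i := by
    fin_cases i <;> simp only [chainSin] <;> simp <;> fun_prop
  have hrad : Continuous fun θ => (porismChain Γ γ (Real.cos θ) (Real.sin θ) σ i).radius := by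
    refine Continuous.inv₀ ?_ fun θ => (porismCurvature_pos h (neg_one_le_of_sq_add_sq
      (chainCos_sq_add_chainSin_sq (Real.cos_sq_add_sin_sq θ) hσ i))).ne'
    unfold porismCurvature
    fun_prop
  have hcen : Continuous fun θ => (porismChain Γ γ (Real.cos θ) (Real.sin θ) σ i).center := by
    refine continuous_framePoint ?_ ?_
    · exact (continuous_const.sub (continuous_const.mul hrad)).div_const _
    · exact (continuous_const.mul hsin).mul hrad
  have h1 := Metric.tendsto_nhds.1 (hcen.tendsto θ₀) ε hε
  have h2 := Metric.tendsto_nhds.1 (hrad.tendsto θ₀) ε hε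
  filter_upwards [h1, h2] with θ h1 h2
  rw [dist_comm] at h1 h2
  exact ⟨h1, h2⟩

theorem cos_sq_mul_sin_sq_deriv (θ : ℝ) :
    HasDerivAt (fun θ => Real.cos θ ^ 2 * Real.sin θ ^ 2)
      (2 * (Real.cos θ * Real.sin θ) * (Real.cos θ ^ 2 - Real.sin θ ^ 2)) θ := by
  have := ((Real.hasDerivAt_cos θ).pow 2).mul ((Real.hasDerivAt_sin θ).pow 2)
  refine this.congr_deriv ?_
  simp
  ring

theorem cos_mul_sin_eq_zero_of_isLocalMin {θ : ℝ}
    (hθ : IsLocalMin (fun θ => Real.cos θ ^ 2 * Real.sin θ ^ 2) θ) :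
    Real.cos θ * Real.sin θ = 0 := by
  have hd := hθ.hasDerivAt_eq_zero (cos_sq_mul_sin_sq_deriv θ)
  rcases mul_eq_zero.1 hd with e | e
  · linarith
  exfalso
  -- At the other critical points the value is the global maximum 1/4. A local minimum there would
  -- make the function constant nearby, hence cos² - sin² identically zero nearby; differentiating
  -- gives cos θ sin θ = 0, against the value 1/4.
  have e4 := (sq_mul_sq_eq_quarter_iff (Real.cos_sq_add_sin_sq θ)).2 (sub_eq_zero.1 e)
  have hev : (fun t => Real.cos t ^ 2 - Real.sin t ^ 2) =ᶠ[𝓝 θ] fun _ => (0 : ℝ) := by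
    filter_upwards [hθ] with t ht
    rw [e4] at ht
    have ht1 := Real.cos_sq_add_sin_sq t
    exact sub_eq_zero.2 ((sq_mul_sq_eq_quarter_iff ht1).1 ((sq_mul_sq_le_quarter ht1).antisymm ht))
  have hder := ((Real.hasDerivAt_cos θ).pow 2).sub ((Real.hasDerivAt_sin θ).pow 2)
  have h0 := hder.unique ((hasDerivAt_const θ (0 : ℝ)).congr_of_eventuallyEq hev)
  simp at h0
  have h1 : Real.cos θ * Real.sin θ = 0 := by linarith
  rw [← mul_pow, h1] at e4
  norm_num at e4

theorem cos_sq_eq_sin_sq_of_isLocalMax {θ : ℝ}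
    (hθ : IsLocalMax (fun θ => Real.cos θ ^ 2 * Real.sin θ ^ 2) θ) :
    Real.cos θ ^ 2 = Real.sin θ ^ 2 := by
  have hd := hθ.hasDerivAt_eq_zero (cos_sq_mul_sin_sq_deriv θ)
  rcases mul_eq_zero.1 hd with e | e
  swap
  · linarith
  exfalso
  -- Dually, the value here is the global minimum 0, so a local maximum would make cos · sin vanish
  -- nearby. Its derivative cos² - sin² would vanish too, forcing the value 1/4.
  have e0 : Real.cos θ * Real.sin θ = 0 := by linarith
  have hev : (fun t => Real.cos t * Real.sin t) =ᶠ[𝓝 θ] fun _ => (0 : ℝ) := by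
    filter_upwards [hθ] with t ht
    rw [← mul_pow, ← mul_pow, e0] at ht
    exact pow_eq_zero_iff two_ne_zero |>.1 (le_antisymm (by simpa using ht) (sq_nonneg _))
  have hder := (Real.hasDerivAt_cos θ).mul (Real.hasDerivAt_sin θ)
  have h0 := hder.unique ((hasDerivAt_const θ (0 : ℝ)).congr_of_eventuallyEq hev)
  have h1 : Real.cos θ ^ 2 = Real.sin θ ^ 2 := by linarith
  have h2 := (sq_mul_sq_eq_quarter_iff (Real.cos_sq_add_sin_sq θ)).2 h1
  rw [← mul_pow, e0] at h2
  norm_num at h2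

theorem isLocalMaxArea_iff (h : IsParentPair Γ γ) (C : Fin 4 → Sphere Plane) :
    IsLocalMaxArea Γ γ C ↔ IsAxialChain Γ γ C := by
  -- Axial chains are global maxima, so the neighbourhood size 1 is arbitrary. The area decreases in
  -- p, so a local maximum of the area is a local minimum of p.
  refine ⟨fun ⟨hC, ε, hε, hmax⟩ => ?_, fun hC => ⟨hC.chain, 1, one_pos, fun D hD _ => ?_⟩⟩
  · obtain ⟨u, w, σ, hu, hσ, rfl⟩ := (isSteinerChain_iff h).1 hC
    obtain ⟨θ₀, rfl, rfl⟩ := exists_cos_sin_eq hu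
    rw [isAxialChain_porismChain_iff h hu hσ]
    refine cos_mul_sin_eq_zero_of_isLocalMin ?_
    filter_upwards [eventually_chainsClose h hσ θ₀ hε] with θ hθ
    have hu' := Real.cos_sq_add_sin_sq θ
    have := hmax _ (isSteinerChain_porismChain h hu' hσ) hθ
    rwa [chainArea_porismChain h hu hσ, chainArea_porismChain h hu' hσ,
      porismArea_le_iff h (by positivity) (sq_mul_sq_le_quarter hu') (by positivity)
        (sq_mul_sq_le_quarter hu)] at this
  · rw [(chainArea_eq_max_iff h hC.chain).2 hC]
    exact chainArea_le_max h hD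

theorem isLocalMinArea_iff (h : IsParentPair Γ γ) (C : Fin 4 → Sphere Plane) :
    IsLocalMinArea Γ γ C ↔ IsLateralChain Γ γ C := by
  refine ⟨fun ⟨hC, ε, hε, hmin⟩ => ?_, fun hC => ⟨hC.chain, 1, one_pos, fun D hD _ => ?_⟩⟩
  · obtain ⟨u, w, σ, hu, hσ, rfl⟩ := (isSteinerChain_iff h).1 hC
    obtain ⟨θ₀, rfl, rfl⟩ := exists_cos_sin_eq hu
    rw [isLateralChain_porismChain_iff h hu hσ]
    refine cos_sq_eq_sin_sq_of_isLocalMax ?_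
    filter_upwards [eventually_chainsClose h hσ θ₀ hε] with θ hθ
    have hu' := Real.cos_sq_add_sin_sq θ
    have := hmin _ (isSteinerChain_porismChain h hu' hσ) hθ
    rwa [chainArea_porismChain h hu hσ, chainArea_porismChain h hu' hσ,
      porismArea_le_iff h (by positivity) (sq_mul_sq_le_quarter hu) (by positivity)
        (sq_mul_sq_le_quarter hu')] at this
  · rw [(chainArea_eq_min_iff h hC.chain).2 hC]
    exact min_le_chainArea h hD

theorem ncard_axial (h : IsParentPair Γ γ) :
    {S | ∃ C, IsAxialChain Γ γ C ∧ Set.range C = S}.ncard = 1 := by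
  refine Set.ncard_eq_one.2 ⟨Set.range (porismChain Γ γ 1 0 1), Set.ext fun S => ⟨?_, ?_⟩⟩
  · rintro ⟨C, hC, rfl⟩
    obtain ⟨u, w, σ, hu, hσ, rfl⟩ := (isSteinerChain_iff h).1 hC.chain
    exact range_porismChain_axial hu hσ ((isAxialChain_porismChain_iff h hu hσ).1 hC)
  · rintro rfl
    exact ⟨_, isAxialChain_porismChain_one_zero h, rfl⟩

theorem ncard_lateral (h : IsParentPair Γ γ) :
    {S | ∃ C, IsLateralChain Γ γ C ∧ Set.range C = S}.ncard = 1 := by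
  refine Set.ncard_eq_one.2 ⟨Set.range (porismChain Γ γ √2⁻¹ √2⁻¹ 1), Set.ext fun S => ⟨?_, ?_⟩⟩
  · rintro ⟨C, hC, rfl⟩
    obtain ⟨u, w, σ, hu, hσ, rfl⟩ := (isSteinerChain_iff h).1 hC.chain
    exact range_porismChain_lateral hu hσ ((isLateralChain_porismChain_iff h hu hσ).1 hC)
  · rintro rfl
    exact ⟨_, isLateralChain_porismChain_sqrt_half h, rfl⟩

/-- A lateral chain can be labelled from any of its circles, whose cosines are ±√(1/2); curvature is
injective in the cosine. -/
theorem ncard_lateral_curvature (h : IsParentPair Γ γ) :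
    {t : ℝ | ∃ C, IsLateralChain Γ γ C ∧ t = 1 / (C 0).radius}.ncard = 2 := by
  have hr : ∀ u w σ, 1 / (porismChain Γ γ u w σ 0).radius = porismCurvature Γ γ u := fun u w σ => by
    simp [porismChain, porismCircle, chainCos]
  have hset : {t : ℝ | ∃ C, IsLateralChain Γ γ C ∧ t = 1 / (C 0).radius} =
      {porismCurvature Γ γ √2⁻¹, porismCurvature Γ γ (-√2⁻¹)} := by
    ext t
    constructor
    · rintro ⟨C, hC, rfl⟩
      obtain ⟨u, w, σ, hu, hσ, rfl⟩ := (isSteinerChain_iff h).1 hC.chain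
      rw [hr]
      rcases eq_or_eq_neg_of_sq_eq hu ((isLateralChain_porismChain_iff h hu hσ).1 hC) with
        rfl | rfl
      · exact .inl rfl
      · exact .inr rfl
    · rintro (rfl | rfl)
      · exact ⟨_, isLateralChain_porismChain_sqrt_half h, (hr _ _ _).symm⟩
      · refine ⟨porismChain Γ γ (-√2⁻¹) √2⁻¹ 1, ?_, (hr _ _ _).symm⟩
        exact (isLateralChain_porismChain_iff h (by rw [neg_sq, two_mul_sqrt_half_sq])
          (by norm_num)).2 (neg_sq _)
  rw [hset, Set.ncard_pair]
  rw [Ne, porismCurvature_inj h]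
  have : 0 < √(2⁻¹ : ℝ) := by positivity
  intro e
  linarith

end Extrema

/-! ### The main theorem. -/

theorem mainTheorem2 (Γ γ : EuclideanGeometry.Sphere Plane) (hpar : IsParentPair Γ γ)
    (a A : ℝ) (ha : a = 1 / γ.radius) (hA : A = -(1 / Γ.radius)) :
    -- the axi-symmetric chains are the axial and the lateral ones
    (∀ C, IsSteinerChain Γ γ C →
      (IsAxiSymmetric Γ γ C ↔ IsAxialChain Γ γ C ∨ IsLateralChain Γ γ C)) ∧
    -- up to labelling there is one axial chain and one lateral chain; labelled lateral chains
    -- realise exactly two values of the curvature of the first circle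
    {S | ∃ C, IsAxialChain Γ γ C ∧ Set.range C = S}.ncard = 1 ∧
    {S | ∃ C, IsLateralChain Γ γ C ∧ Set.range C = S}.ncard = 1 ∧
    {t : ℝ | ∃ C, IsLateralChain Γ γ C ∧ t = 1 / (C 0).radius}.ncard = 2 ∧
    -- local extrema of the area occur exactly at these chains
    (∀ C, IsLocalMaxArea Γ γ C ↔ IsAxialChain Γ γ C) ∧
    (∀ C, IsLocalMinArea Γ γ C ↔ IsLateralChain Γ γ C) ∧
    -- the maximum and where it is attained
    IsGreatest {s : ℝ | ∃ C, IsSteinerChain Γ γ C ∧ chainArea C = s}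
      ((A ^ 4 + 6 * A ^ 3 * a + 18 * A ^ 2 * a ^ 2 + 6 * A * a ^ 3 + a ^ 4) /
        (A ^ 2 * a ^ 2 * (a + A) ^ 2) * Real.pi) ∧
    (∀ C, IsSteinerChain Γ γ C →
      (chainArea C = (A ^ 4 + 6 * A ^ 3 * a + 18 * A ^ 2 * a ^ 2 + 6 * A * a ^ 3 + a ^ 4) /
        (A ^ 2 * a ^ 2 * (a + A) ^ 2) * Real.pi ↔ IsAxialChain Γ γ C)) ∧
    -- the minimum and where it is attained
    IsLeast {s : ℝ | ∃ C, IsSteinerChain Γ γ C ∧ chainArea C = s}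
      (32 * (3 * a + A) * (a + 3 * A) / (a - A) ^ 4 * Real.pi) ∧
    (∀ C, IsSteinerChain Γ γ C →
      (chainArea C = 32 * (3 * a + A) * (a + 3 * A) / (a - A) ^ 4 * Real.pi ↔
        IsLateralChain Γ γ C)) := by
  rw [← porismArea_zero hpar ha hA, ← porismArea_quarter hpar ha hA]
  have hax := isAxialChain_porismChain_one_zero hpar
  have hlat := isLateralChain_porismChain_sqrt_half hpar
  refine ⟨fun C hC => ?_, ncard_axial hpar, ncard_lateral hpar, ncard_lateral_curvature hpar,
    isLocalMaxArea_iff hpar, isLocalMinArea_iff hpar,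
    ⟨⟨_, hax.chain, (chainArea_eq_max_iff hpar hax.chain).2 hax⟩, ?_⟩,
    fun C hC => chainArea_eq_max_iff hpar hC,
    ⟨⟨_, hlat.chain, (chainArea_eq_min_iff hpar hlat.chain).2 hlat⟩, ?_⟩,
    fun C hC => chainArea_eq_min_iff hpar hC⟩
  · obtain ⟨u, w, σ, hu, hσ, rfl⟩ := (isSteinerChain_iff hpar).1 hC
    rw [isAxiSymmetric_porismChain_iff hpar hu hσ, isAxialChain_porismChain_iff hpar hu hσ,
      isLateralChain_porismChain_iff hpar hu hσ]
  · rintro _ ⟨C, hC, rfl⟩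
    exact chainArea_le_max hpar hC
  · rintro _ ⟨C, hC, rfl⟩
    exact min_le_chainArea hpar hC
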